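/- Let $\mathcal H$ be an infinite-dimensional separable complex Hilbert space and let $\mathcal P(\mathcal H)=\{P\in\mathcal B(\mathcal H): P=P^2=P^*\}$ be the set of orthogonal projections, with the topology of the operator norm. For $0\le i,j\le\infty$ with $i+j=\infty$ let $\mathcal P_{i,j}$ be the set of $P\in\mathcal P(\mathcal H)$ of rank $\dim R(P)=i$ and corank $\dim N(P)=j$. Let $\mathbf\Delta\subset\mathcal P(\mathcal H)\times\mathcal P(\mathcal H)$ be the set of pairs $(P,Q)$ whose ranges have a common complement, i.e. for which there is a closed subspace $\mathcal Z\subset\mathcal H$ with $R(P)\,\dot{+}\,\mathcal Z=R(Q)\,\dot{+}\,\mathcal Z=\mathcal H$ (direct sums, not necessarily orthogonal), and let $\mathbf\Delta_\infty=\mathbf\Delta\cap(\mathcal P_{\infty,\infty}\times\mathcal P_{\infty,\infty})$. Then $\mathbf\Delta_\infty$ is (non-empty and) arcwise connected: any two of its points are joined by a norm-continuous path inside $\mathbf\Delta_\infty$. Moreover $\mathbf\Delta_\infty$ is a connected component of $\mathbf\Delta$, and the connected components of $\mathbf\Delta$ are exactly the sets $\mathcal P_{i,j}\times\mathcal P_{i,j}$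 with $i+j=\infty$ and ($i<\infty$ or $j<\infty$), together with $\mathbf\Delta_\infty$. -/

import Mathlib

namespace CommonComplement

variable (H : Type*) [NormedAddCommGroup H] [InnerProductSpace ℂ H] [CompleteSpace H]

/-- The projections `P` of `B(H)`, `P = P² = P*`, with `dim R(P) = i` and `dim N(P) = j`, where all
infinite dimensions are recorded as `⊤`; as a subset of `B(H)` with the operator norm. -/
def Proj (i j : ℕ∞) : Set (H →L[ℂ] H) :=
  {P | IsStarProjection P ∧
    Cardinal.toENat (Module.rank ℂ (LinearMap.range (P : H →ₗ[ℂ] H))) = i ∧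
    Cardinal.toENat (Module.rank ℂ (LinearMap.ker (P : H →ₗ[ℂ] H))) = j}

variable {H} in
/-- `S` and `T` have a common closed complement (algebraic direct sums, not orthogonal ones). -/
def HasCommonComplement (S T : Submodule ℂ H) : Prop :=
  ∃ Z : Submodule ℂ H, IsClosed (Z : Set H) ∧ IsCompl S Z ∧ IsCompl T Z

/-- Pairs of orthogonal projections whose ranges have a common complement. -/
def Delta : Set ((H →L[ℂ] H) × (H →L[ℂ] H)) :=
  {x | IsStarProjection x.1 ∧ IsStarProjection x.2 ∧
    HasCommonComplement (LinearMap.range (x.1 : H →ₗ[ℂ] H)) (LinearMap.range (x.2 : H →ₗ[ℂ] H))}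

/-- The pairs in `Delta` of projections with infinite rank and infinite corank. -/
def DeltaInf : Set ((H →L[ℂ] H) × (H →L[ℂ] H)) :=
  Delta H ∩ Proj H ⊤ ⊤ ×ˢ Proj H ⊤ ⊤

end CommonComplement

/-!
If `e` is an idempotent of a C⋆-algebra and `x = e - e*`, then `(e + e* - 1)² = 1 + x* x`. So
`e + e* - 1` is invertible, and `e (e + e* - 1)⁻¹`, which is the orthogonal projection with the same
range as `e`, depends continuously on `e`. The idempotents with a prescribed kernel `Z` form a
convex set, so the orthogonal projections whose range is a complement of `Z` form a path connected
set. Hence projections with a common complement `Z` are joined by a path, along which `Z` stays a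
common complement.

Two projections of the same finite rank, or of the same finite corank, have a common complement, and
so do two projections of infinite rank with orthogonal ranges `S` and `T`: take the kernel of
`P_S - u⁻¹ P_T` with `u : S ≃ T` an isometry. Projections `P` and `Q` of infinite rank and corank
are joined through `P, E, F, Q`, where the ranges of `E` and `F` are orthogonal and contained in the
kernels of `P` and `Q`; these are spanned by the two halves of an orthonormal sequence picked
alternately from both kernels. A pair `(P, Q)` in `Delta` is joined to `(Q, Q)`, so paths of
projections give paths in `Delta`. Finally `‖P - Q‖ < 1` forces equal ranks and coranks, so these
are constant on connected sets.
-/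

namespace CommonComplement

open Submodule ContinuousLinearMap

section Algebra

variable {K V : Type*} [AddCommGroup V]

theorem isCompl_range_add [Ring K] [Module K V] {A : Type*} [AddCommGroup A] [Module K A]
    {S : Submodule K V} {f g : A →ₗ[K] V} (hf : f.range ≤ S) (hg : Function.Injective g)
    (h : IsCompl S g.range) : IsCompl S (f + g).range := by
  have hfS (a : A) : f a ∈ S := hf ⟨a, rfl⟩
  refine ⟨disjoint_def.2 ?_, codisjoint_iff_le_sup.2 ?_⟩
  · rintro _ hx ⟨a, rfl⟩
    have hgS : g a ∈ S := by simpa using S.sub_mem hx (hfS a)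
    have hga : g a = 0 := disjoint_def.1 h.disjoint _ hgS ⟨a, rfl⟩
    rw [(map_eq_zero_iff g hg).1 hga, map_zero]
  · rw [← h.sup_eq_top]
    refine sup_le le_sup_left ?_
    rintro _ ⟨a, rfl⟩
    simpa using add_mem_sup (S.neg_mem (hfS a)) (LinearMap.mem_range_self (f + g) a)

theorem isCompl_range_add_sup [Ring K] [Module K V] {A : Type*} [AddCommGroup A] [Module K A]
    {S W : Submodule K V} {f g : A →ₗ[K] V} (hf : f.range ≤ S) (hg : Function.Injective g)
    (hgW : Disjoint g.range W) (h : IsCompl S (g.range ⊔ W)) :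
    IsCompl S ((f + g).range ⊔ W) := by
  have hinj : Function.Injective (g.coprod W.subtype) := by
    rw [← LinearMap.ker_eq_bot, LinearMap.ker_coprod_of_disjoint_range _ _ (by simpa using hgW),
      LinearMap.ker_eq_bot.2 hg, ker_subtype, prod_bot]
  have hrange := isCompl_range_add (f := f.coprod 0)
    (by simpa [LinearMap.range_coprod] using hf) hinj (by simpa [LinearMap.range_coprod] using h)
  have hcoprod : f.coprod 0 + g.coprod W.subtype = (f + g).coprod W.subtype := by ext <;> simp
  rwa [hcoprod, LinearMap.range_coprod, range_subtype] at hrange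

theorem exists_isCompl_sup_of_linearEquiv [Ring K] [Module K V] {S T S' T' W : Submodule K V}
    (hS' : S' ≤ S) (hT' : T' ≤ T) (hST : IsCompl S (T' ⊔ W)) (hTS : IsCompl T (S' ⊔ W))
    (hS'W : Disjoint S' W) (hT'W : Disjoint T' W) (e : S' ≃ₗ[K] T') :
    ∃ g : S' →ₗ[K] V, IsCompl S (g.range ⊔ W) ∧ IsCompl T (g.range ⊔ W) := by
  have he : (T'.subtype ∘ₗ e.toLinearMap).range = T' := by
    rw [LinearMap.range_comp_of_range_eq_top _ e.range, range_subtype]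
  refine ⟨S'.subtype + T'.subtype ∘ₗ e.toLinearMap, isCompl_range_add_sup (by simpa)
    (T'.subtype_injective.comp e.injective) (by rwa [he]) (by rwa [he]), ?_⟩
  rw [add_comm]
  exact isCompl_range_add_sup (he.trans_le hT') S'.subtype_injective (by simpa) (by simpa)

theorem exists_le_disjoint_sup_eq_sup {α : Type*} [Lattice α] [BoundedOrder α]
    [IsModularLattice α] [ComplementedLattice α] (a b : α) :
    ∃ b' ≤ b, Disjoint a b' ∧ a ⊔ b' = a ⊔ b := by
  obtain ⟨b', hd, hsup⟩ :=
    IsModularLattice.exists_disjoint_and_sup_eq (inf_le_right : a ⊓ b ≤ b)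
  have hb' : b' ≤ b := hsup ▸ le_sup_right
  refine ⟨b', hb', ?_, ?_⟩
  · rw [disjoint_iff_inf_le] at hd ⊢
    exact le_trans (le_inf (inf_le_inf_left a hb') inf_le_right) hd
  · rw [← hsup, ← sup_assoc, sup_inf_self]

variable [DivisionRing K] [Module K V] {S T : Submodule K V}

theorem finrank_sup_of_disjoint [FiniteDimensional K S] [FiniteDimensional K T]
    (h : Disjoint S T) : Module.finrank K ↥(S ⊔ T) = Module.finrank K S + Module.finrank K T := by
  rw [← finrank_sup_add_finrank_inf_eq, h.eq_bot, finrank_bot, add_zero]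

theorem exists_finiteDimensional_isCompl_sup_of_finrank_eq [FiniteDimensional K S]
    [FiniteDimensional K T] (h : Module.finrank K S = Module.finrank K T) {W : Submodule K V}
    (hW : IsCompl (S ⊔ T) W) :
    ∃ D : Submodule K V, FiniteDimensional K D ∧ IsCompl S (D ⊔ W) ∧ IsCompl T (D ⊔ W) := by
  obtain ⟨T', hT', hST', hT'sup⟩ := exists_le_disjoint_sup_eq_sup S T
  obtain ⟨S', hS', hTS', hS'sup⟩ := exists_le_disjoint_sup_eq_sup T S
  rw [sup_comm T S] at hS'sup
  have := finiteDimensional_of_le hS'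
  have := finiteDimensional_of_le hT'
  have hfinrank : Module.finrank K S' = Module.finrank K T' := by
    have h₁ := finrank_sup_of_disjoint hST'
    have h₂ := finrank_sup_of_disjoint hTS'
    rw [hT'sup] at h₁
    rw [hS'sup] at h₂
    omega
  obtain ⟨g, hgS, hgT⟩ := exists_isCompl_sup_of_linearEquiv hS' hT'
    (hST'.isCompl_sup_right_of_isCompl_sup_left (hT'sup ▸ hW))
    (hTS'.isCompl_sup_right_of_isCompl_sup_left (hS'sup ▸ hW))
    (hW.disjoint.mono_left (hS'.trans le_sup_left))
    (hW.disjoint.mono_left (hT'.trans le_sup_right)) (LinearEquiv.ofFinrankEq S' T' hfinrank)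
  exact ⟨g.range, inferInstance, hgS, hgT⟩

theorem finiteDimensional_of_isCompl [FiniteDimensional K (V ⧸ S)] {Z : Submodule K V}
    (h : IsCompl S Z) : FiniteDimensional K Z :=
  (quotientEquivOfIsCompl S Z h).finiteDimensional

theorem finrank_add_finrank_of_isCompl_sup [FiniteDimensional K (V ⧸ S)]
    {D W : Submodule K V} (hDW : Disjoint D W) (h : IsCompl S (D ⊔ W)) :
    Module.finrank K D + Module.finrank K W = Module.finrank K (V ⧸ S) := by
  have := finiteDimensional_of_isCompl h
  have : FiniteDimensional K D := finiteDimensional_of_le (le_sup_left : D ≤ D ⊔ W)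
  have : FiniteDimensional K W := finiteDimensional_of_le (le_sup_right : W ≤ D ⊔ W)
  rw [← finrank_sup_of_disjoint hDW, (quotientEquivOfIsCompl S _ h).finrank_eq]

theorem exists_isCompl_isCompl_of_finrank_quotient_eq [FiniteDimensional K (V ⧸ S)]
    [FiniteDimensional K (V ⧸ T)] (h : Module.finrank K (V ⧸ S) = Module.finrank K (V ⧸ T)) :
    ∃ Z : Submodule K V, IsCompl S Z ∧ IsCompl T Z := by
  obtain ⟨T', hT', hST', hT'sup⟩ := exists_le_disjoint_sup_eq_sup S T
  obtain ⟨S', hS', hTS', hS'sup⟩ := exists_le_disjoint_sup_eq_sup T S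
  obtain ⟨W, hW⟩ := (S ⊔ T).exists_isCompl
  have hT'W : Disjoint T' W := hW.disjoint.mono_left (hT'.trans le_sup_right)
  have hS'W : Disjoint S' W := hW.disjoint.mono_left (hS'.trans le_sup_left)
  have hS : IsCompl S (T' ⊔ W) := hST'.isCompl_sup_right_of_isCompl_sup_left (hT'sup ▸ hW)
  have hT : IsCompl T (S' ⊔ W) :=
    hTS'.isCompl_sup_right_of_isCompl_sup_left (hS'sup ▸ sup_comm S T ▸ hW)
  have := finiteDimensional_of_isCompl hS
  have := finiteDimensional_of_isCompl hT
  have : FiniteDimensional K T' := finiteDimensional_of_le (le_sup_left : T' ≤ T' ⊔ W)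
  have : FiniteDimensional K S' := finiteDimensional_of_le (le_sup_left : S' ≤ S' ⊔ W)
  have hfinrank : Module.finrank K S' = Module.finrank K T' := by
    have h₁ := finrank_add_finrank_of_isCompl_sup hT'W hS
    have h₂ := finrank_add_finrank_of_isCompl_sup hS'W hT
    omega
  obtain ⟨g, hgS, hgT⟩ := exists_isCompl_sup_of_linearEquiv hS' hT' hS hT hS'W hT'W
    (LinearEquiv.ofFinrankEq S' T' hfinrank)
  exact ⟨_, hgS, hgT⟩

end Algebra

section CStar

theorem isIdempotentElem_of_mul_eq {M : Type*} [Semigroup M] {e g : M} (heg : e * g = e)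
    (hge : g * e = g) : IsIdempotentElem g := by
  rw [IsIdempotentElem]
  nth_rw 1 [← hge]
  rw [mul_assoc, heg, hge]

theorem convex_setOf_mul_eq {A : Type*} [Ring A] [Algebra ℝ A] (e : A) :
    Convex ℝ {g : A | e * g = e ∧ g * e = g} := by
  rintro g ⟨heg, hge⟩ h ⟨heh, hhe⟩ a b - - hab
  constructor
  · rw [mul_add, mul_smul_comm, mul_smul_comm, heg, heh, ← add_smul, hab, one_smul]
  · rw [add_mul, smul_mul_assoc, smul_mul_assoc, hge, hhe]

/-- The self-adjoint idempotent with the same range as the idempotent `e`, given by the formula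
`e (e + e* - 1)⁻¹` of Kovarik. In a C⋆-algebra `e + e* - 1` is then invertible, so the junk value of
`Ring.inverse` at non-units never occurs for idempotents. -/
noncomputable def rangeProjection {A : Type*} [Ring A] [StarRing A] (e : A) : A :=
  e * Ring.inverse (e + star e - 1)

variable {A : Type*} [CStarAlgebra A] {e : A}

theorem isUnit_one_add_star_mul_self (a : A) : IsUnit (1 + star a * a) := by
  by_contra h
  have hspec : (-1 : ℝ) ∈ spectrum ℝ (star a * a) := by
    rw [spectrum.mem_iff, ← IsUnit.neg_iff]
    simpa [add_comm] using h
  linarith [spectrum_star_mul_self_nonneg _ hspec]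

theorem isUnit_add_star_sub_one (he : IsIdempotentElem e) : IsUnit (e + star e - 1) := by
  have hsq : (e + star e - 1) * (e + star e - 1) = 1 + star (e - star e) * (e - star e) := by
    have hs : star e * star e = star e := he.star.eq
    simp only [star_sub, star_star, mul_add, add_mul, mul_sub, sub_mul, he.eq, hs]
    noncomm_ring
  have hunit := isUnit_one_add_star_mul_self (e - star e)
  rw [← hsq] at hunit
  exact ((Commute.refl _).isUnit_mul_iff.1 hunit).1

theorem mul_rangeProjection (he : IsIdempotentElem e) :
    e * rangeProjection e = rangeProjection e := by
  rw [rangeProjection, ← mul_assoc, he.eq]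

theorem inverse_mul_star_eq_rangeProjection (he : IsIdempotentElem e) :
    Ring.inverse (e + star e - 1) * star e = rangeProjection e := by
  have hu := isUnit_add_star_sub_one he
  have hs : star e * star e = star e := he.star.eq
  rw [rangeProjection, Ring.inverse_mul_eq_iff_eq_mul _ _ _ hu, ← mul_assoc,
    Ring.eq_mul_inverse_iff_mul_eq _ _ _ hu]
  simp only [mul_add, add_mul, mul_sub, sub_mul, he.eq, hs]
  noncomm_ring

theorem rangeProjection_mul (he : IsIdempotentElem e) : rangeProjection e * e = e := by
  have hu := isUnit_add_star_sub_one he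
  rw [← inverse_mul_star_eq_rangeProjection he, mul_assoc, Ring.inverse_mul_eq_iff_eq_mul _ _ _ hu]
  simp only [add_mul, sub_mul, he.eq]
  noncomm_ring

theorem isStarProjection_rangeProjection (he : IsIdempotentElem e) :
    IsStarProjection (rangeProjection e) where
  isIdempotentElem := by
    rw [IsIdempotentElem]
    nth_rw 2 [rangeProjection]
    rw [← mul_assoc, rangeProjection_mul he, rangeProjection]
  isSelfAdjoint := by
    rw [IsSelfAdjoint, ← inverse_mul_star_eq_rangeProjection he, star_mul, star_star,
      ← Ring.inverse_star, star_sub, star_add, star_star, star_one, add_comm (star e)]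
    exact (inverse_mul_star_eq_rangeProjection he).symm

theorem continuousOn_rangeProjection :
    ContinuousOn rangeProjection {e : A | IsIdempotentElem e} := by
  intro e he
  obtain ⟨u, hu⟩ := isUnit_add_star_sub_one he
  have hinv : ContinuousAt Ring.inverse (e + star e - 1) := hu ▸ NormedRing.inverse_continuousAt u
  have hcont : ContinuousAt (fun e : A ↦ e + star e - 1) e := by fun_prop
  exact (continuousAt_id.mul (hinv.comp (f := fun e : A ↦ e + star e - 1) hcont)).continuousWithinAt

end CStar

section Idempotents

section Topological

variable {R M : Type*} [Ring R] [TopologicalSpace M] [AddCommGroup M] [Module R M] {P Q : M →L[R] M}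

theorem mul_eq_left_iff_ker_le (hQ : IsIdempotentElem Q) : P * Q = P ↔ Q.ker ≤ P.ker := by
  rw [← LinearMap.IsIdempotentElem.comp_eq_left_iff hQ.toLinearMap, ← ContinuousLinearMap.coe_inj]
  rfl

theorem ker_eq_range_one_sub [IsTopologicalAddGroup M] (hP : IsIdempotentElem P) :
    P.ker = (1 - P).range :=
  LinearMap.IsIdempotentElem.ker_eq_range_one_sub hP.toLinearMap

end Topological

section Hilbert

variable {H : Type*} [NormedAddCommGroup H] [InnerProductSpace ℂ H] [CompleteSpace H]

theorem range_rangeProjection {G : H →L[ℂ] H} (hG : IsIdempotentElem G) :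
    (rangeProjection G).range = G.range := by
  apply le_antisymm
  · rw [← mul_rangeProjection hG]
    exact LinearMap.range_comp_le_range _ _
  · nth_rw 1 [← rangeProjection_mul hG]
    exact LinearMap.range_comp_le_range _ _

theorem isPathConnected_setOf_isStarProjection_isCompl_range {Z : Submodule ℂ H}
    (hZ : IsClosed (Z : Set H)) :
    IsPathConnected {R : H →L[ℂ] H | IsStarProjection R ∧ IsCompl R.range Z} := by
  have := hZ.completeSpace_coe
  let E : H →L[ℂ] H := Zᗮ.starProjection
  have hE : IsIdempotentElem E := Zᗮ.isIdempotentElem_starProjection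
  have hEZ : E.ker = Z := by simp [E]
  have himage : {R : H →L[ℂ] H | IsStarProjection R ∧ IsCompl R.range Z} =
      rangeProjection '' {G | E * G = E ∧ G * E = G} := by
    ext R
    constructor
    · rintro ⟨hR, hRZ⟩
      have hRZtop := hRZ.isTopCompl_of_isClosed hR.isIdempotentElem.isClosed_range hZ
      let G := R.range.projectionL Z hRZtop
      have hG : IsIdempotentElem G := isIdempotentElem_projectionL hRZtop
      have hker : G.ker = E.ker := by rw [ker_projectionL, hEZ]
      refine ⟨G, ⟨(mul_eq_left_iff_ker_le hG).2 hker.le, (mul_eq_left_iff_ker_le hE).2 hker.ge⟩,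
        IsStarProjection.ext (isStarProjection_rangeProjection hG) hR ?_⟩
      rw [range_rangeProjection hG, range_projectionL]
    · rintro ⟨G, ⟨hEG, hGE⟩, rfl⟩
      have hG := isIdempotentElem_of_mul_eq hEG hGE
      refine ⟨isStarProjection_rangeProjection hG, ?_⟩
      have hker : G.ker = E.ker := le_antisymm ((mul_eq_left_iff_ker_le hG).1 hEG)
        ((mul_eq_left_iff_ker_le hE).1 hGE)
      rw [range_rangeProjection hG, ← hEZ, ← hker]
      exact hG.isTopCompl.isCompl
  rw [himage]
  exact ((convex_setOf_mul_eq E).isPathConnected ⟨E, hE.eq, hE.eq⟩).image'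
    (continuousOn_rangeProjection.mono fun G hG ↦ isIdempotentElem_of_mul_eq hG.1 hG.2)

end Hilbert

section Rank

variable {𝕜 E : Type*} [NontriviallyNormedField 𝕜] [NormedAddCommGroup E] [NormedSpace 𝕜 E]
  {P Q : E →L[𝕜] E}

theorem rank_range_le_of_norm_sub_lt_one (hP : IsIdempotentElem P) (h : ‖P - Q‖ < 1) :
    Module.rank 𝕜 P.range ≤ Module.rank 𝕜 Q.range := by
  have hinj : Function.Injective (Q.rangeRestrict.toLinearMap ∘ₗ P.range.subtype) := by
    rw [injective_iff_map_eq_zero]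
    intro x hx
    have hPx : P x = x := (LinearMap.IsIdempotentElem.mem_range_iff hP.toLinearMap).1 x.2
    have hQx : Q x = 0 := congrArg Subtype.val hx
    by_contra hne
    have hle : ‖(x : E)‖ ≤ ‖P - Q‖ * ‖(x : E)‖ := by simpa [hPx, hQx] using (P - Q).le_opNorm x
    exact (mul_lt_of_lt_one_left (by simpa using hne) h).not_ge hle
  exact LinearMap.rank_le_of_injective _ hinj

theorem rank_range_eq_of_norm_sub_lt_one (hP : IsIdempotentElem P) (hQ : IsIdempotentElem Q)
    (h : ‖P - Q‖ < 1) : Module.rank 𝕜 P.range = Module.rank 𝕜 Q.range :=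
  (rank_range_le_of_norm_sub_lt_one hP h).antisymm
    (rank_range_le_of_norm_sub_lt_one hQ (by rwa [norm_sub_rev]))

theorem rank_range_eq_of_isPreconnected {s : Set (E →L[𝕜] E)} (hs : IsPreconnected s)
    (hidem : ∀ P ∈ s, IsIdempotentElem P) (hP : P ∈ s) (hQ : Q ∈ s) :
    Module.rank 𝕜 P.range = Module.rank 𝕜 Q.range := by
  refine hs.induction₂ (fun P Q ↦ Module.rank 𝕜 P.range = Module.rank 𝕜 Q.range) (fun P hP ↦ ?_)
    (fun _ _ _ _ _ _ ↦ Eq.trans) (fun _ _ _ _ ↦ Eq.symm) hP hQ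
  filter_upwards [mem_nhdsWithin_of_mem_nhds (Metric.ball_mem_nhds P one_pos),
    self_mem_nhdsWithin] with Q hQball hQ
  exact rank_range_eq_of_norm_sub_lt_one (hidem P hP) (hidem Q hQ)
    (by rwa [mem_ball_iff_norm'] at hQball)

theorem rank_ker_eq_of_isPreconnected {s : Set (E →L[𝕜] E)} (hs : IsPreconnected s)
    (hidem : ∀ P ∈ s, IsIdempotentElem P) (hP : P ∈ s) (hQ : Q ∈ s) :
    Module.rank 𝕜 P.ker = Module.rank 𝕜 Q.ker := by
  rw [ker_eq_range_one_sub (hidem P hP), ker_eq_range_one_sub (hidem Q hQ)]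
  refine rank_range_eq_of_isPreconnected (hs.image (1 - ·) (by fun_prop)) ?_
    (Set.mem_image_of_mem _ hP) (Set.mem_image_of_mem _ hQ)
  rintro _ ⟨R, hR, rfl⟩
  exact (hidem R hR).one_sub

end Rank

end Idempotents

section Complements

variable {𝕜 E : Type*} [RCLike 𝕜]

theorem exists_isClosed_isCompl_of_finrank_eq [NormedAddCommGroup E] [NormedSpace 𝕜 E]
    {S T : Submodule 𝕜 E} [FiniteDimensional 𝕜 S] [FiniteDimensional 𝕜 T]
    (h : Module.finrank 𝕜 S = Module.finrank 𝕜 T) :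
    ∃ Z : Submodule 𝕜 E, IsClosed (Z : Set E) ∧ IsCompl S Z ∧ IsCompl T Z := by
  obtain ⟨W, hWclosed, hW⟩ :=
    (ClosedComplemented.of_finiteDimensional (S ⊔ T)).exists_isClosed_isCompl
  obtain ⟨D, hD, hSD, hTD⟩ := exists_finiteDimensional_isCompl_sup_of_finrank_eq h hW
  exact ⟨D ⊔ W, sup_comm W D ▸ isClosed_sup_finiteDimensional W D hWclosed, hSD, hTD⟩

theorem exists_isClosed_isCompl_of_finrank_quotient_eq [NormedAddCommGroup E] [NormedSpace 𝕜 E]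
    {S T : Submodule 𝕜 E} [FiniteDimensional 𝕜 (E ⧸ S)] [FiniteDimensional 𝕜 (E ⧸ T)]
    (h : Module.finrank 𝕜 (E ⧸ S) = Module.finrank 𝕜 (E ⧸ T)) :
    ∃ Z : Submodule 𝕜 E, IsClosed (Z : Set E) ∧ IsCompl S Z ∧ IsCompl T Z := by
  obtain ⟨Z, hSZ, hTZ⟩ := exists_isCompl_isCompl_of_finrank_quotient_eq h
  have := finiteDimensional_of_isCompl hSZ
  exact ⟨Z, Z.closed_of_finiteDimensional, hSZ, hTZ⟩

variable [NormedAddCommGroup E] [InnerProductSpace 𝕜 E]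

theorem exists_isClosed_isCompl_of_isOrtho {S T : Submodule 𝕜 E} [S.HasOrthogonalProjection]
    [T.HasOrthogonalProjection] (h : S ⟂ T) (e : S ≃L[𝕜] T) :
    ∃ Z : Submodule 𝕜 E, IsClosed (Z : Set E) ∧ IsCompl S Z ∧ IsCompl T Z := by
  let f : E →L[𝕜] S :=
    S.orthogonalProjectionOnto - (e.symm : T →L[𝕜] S) ∘L T.orthogonalProjectionOnto
  have hfS (x : S) : f x = x := by
    have hTx : T.orthogonalProjectionOnto (x : E) = 0 :=
      orthogonalProjectionOnto_eq_zero_iff.2 (h x.2)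
    simp [f, hTx]
  have hfT (y : T) : (-((e : S →L[𝕜] T) ∘L f)) y = y := by
    have hSy : S.orthogonalProjectionOnto (y : E) = 0 :=
      orthogonalProjectionOnto_eq_zero_iff.2 (h.symm y.2)
    simp [f, hSy]
  have hker : (-((e : S →L[𝕜] T) ∘L f)).ker = f.ker := by
    ext x
    simp
  exact ⟨f.ker, f.isClosed_ker, (isTopCompl_of_proj hfS).isCompl,
    hker ▸ (isTopCompl_of_proj hfT).isCompl⟩

end Complements

section Orthonormal

variable {𝕜 E : Type*} [RCLike 𝕜] [NormedAddCommGroup E] [InnerProductSpace 𝕜 E]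

theorem exists_norm_eq_one_mem_orthogonal {S F : Submodule 𝕜 E} [FiniteDimensional 𝕜 F]
    (hS : ¬ FiniteDimensional 𝕜 S) : ∃ x ∈ S, x ∈ Fᗮ ∧ ‖x‖ = 1 := by
  have hninj : ¬ Function.Injective (F.orthogonalProjectionOnto.toLinearMap ∘ₗ S.subtype) :=
    fun hinj ↦ hS (Module.Finite.of_injective _ hinj)
  rw [injective_iff_map_eq_zero] at hninj
  push Not at hninj
  obtain ⟨x, hx, hx0⟩ := hninj
  have hxF : (x : E) ∈ Fᗮ := orthogonalProjectionOnto_eq_zero_iff.1 hx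
  exact ⟨(‖(x : E)‖⁻¹ : 𝕜) • (x : E), S.smul_mem _ x.2, Fᗮ.smul_mem _ hxF,
    norm_smul_inv_norm (by simpa using hx0)⟩

theorem exists_orthonormal_forall_mem {V : ℕ → Submodule 𝕜 E}
    (hV : ∀ n, ¬ FiniteDimensional 𝕜 (V n)) : ∃ e : ℕ → E, Orthonormal 𝕜 e ∧ ∀ n, e n ∈ V n := by
  classical
  choose x hxV hxs hx1 using fun (n : ℕ) (s : Finset E) ↦
    exists_norm_eq_one_mem_orthogonal (F := span 𝕜 (s : Set E)) (hV n)
  let s : ℕ → Finset E := Nat.rec ∅ fun n s ↦ insert (x n s) s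
  have hs : Monotone s := monotone_nat_of_le_succ fun n ↦ Finset.subset_insert _ _
  have hortho {m n : ℕ} (hmn : m < n) : inner 𝕜 (x m (s m)) (x n (s n)) = 0 :=
    hxs n (s n) _ (subset_span (hs (Nat.succ_le_of_lt hmn) (Finset.mem_insert_self _ _)))
  refine ⟨fun n ↦ x n (s n), ⟨fun n ↦ hx1 n _, fun m n hmn ↦ ?_⟩, fun n ↦ hxV n _⟩
  rcases hmn.lt_or_gt with hlt | hgt
  · exact hortho hlt
  · exact inner_eq_zero_symm.1 (hortho hgt)

theorem not_finiteDimensional_of_linearIndependent {K V ι : Type*} [DivisionRing K]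
    [AddCommGroup V] [Module K V] [Infinite ι] {v : ι → V} (hv : LinearIndependent K v)
    {S : Submodule K V} (hS : ∀ i, v i ∈ S) : ¬ FiniteDimensional K S := by
  intro hfin
  have hvS : LinearIndependent K fun i ↦ (⟨v i, hS i⟩ : S) := hv.of_comp S.subtype
  exact Infinite.not_finite hvS.finite

theorem isOrtho_topologicalClosure {S T : Submodule 𝕜 E} (h : S ⟂ T) :
    S.topologicalClosure ⟂ T.topologicalClosure := by
  rw [isOrtho_iff_le, orthogonal_closure]
  exact topologicalClosure_minimal _ h (isClosed_orthogonal T)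

theorem exists_isOrtho_of_not_finiteDimensional {S T : Submodule 𝕜 E}
    (hS : IsClosed (S : Set E)) (hT : IsClosed (T : Set E)) (hSinf : ¬ FiniteDimensional 𝕜 S)
    (hTinf : ¬ FiniteDimensional 𝕜 T) :
    ∃ S₁ ≤ S, ∃ T₁ ≤ T, IsClosed (S₁ : Set E) ∧ IsClosed (T₁ : Set E) ∧
      ¬ FiniteDimensional 𝕜 S₁ ∧ ¬ FiniteDimensional 𝕜 T₁ ∧ S₁ ⟂ T₁ := by
  obtain ⟨e, he, heV⟩ := exists_orthonormal_forall_mem (V := fun n ↦ if Even n then S else T)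
    fun n ↦ by by_cases hn : Even n; exacts [by rwa [if_pos hn], by rwa [if_neg hn]]
  have heS (n : ℕ) : e (2 * n) ∈ S := by simpa using heV (2 * n)
  have heT (n : ℕ) : e (2 * n + 1) ∈ T := by simpa using heV (2 * n + 1)
  have hinf {f : ℕ → ℕ} (hf : Function.Injective f) :
      ¬ FiniteDimensional 𝕜 (span 𝕜 (Set.range (e ∘ f))).topologicalClosure :=
    not_finiteDimensional_of_linearIndependent (he.comp f hf).linearIndependent
      fun n ↦ le_topologicalClosure _ (subset_span ⟨n, rfl⟩)
  refine ⟨_, topologicalClosure_minimal _ (span_le.2 (Set.range_subset_iff.2 heS)) hS,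
    _, topologicalClosure_minimal _ (span_le.2 (Set.range_subset_iff.2 heT)) hT,
    isClosed_topologicalClosure _, isClosed_topologicalClosure _,
    hinf (f := (2 * ·)) (fun m n h ↦ by simpa using h),
    hinf (f := (2 * · + 1)) (fun m n h ↦ by simpa using h),
    isOrtho_topologicalClosure (isOrtho_span.2 ?_)⟩
  rintro _ ⟨m, rfl⟩ _ ⟨n, rfl⟩
  exact he.2 (by lia)

theorem countable_of_orthonormal [TopologicalSpace.SeparableSpace E] {ι : Type*} {v : ι → E}
    (hv : Orthonormal 𝕜 v) : Countable ι := by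
  refine Pairwise.countable_of_isOpen_disjoint (s := fun i ↦ Metric.ball (v i) (1 / 2)) ?_
    (fun i ↦ Metric.isOpen_ball) (fun i ↦ ⟨v i, Metric.mem_ball_self (by norm_num)⟩)
  intro i j hij
  have hdist : ‖v i - v j‖ * ‖v i - v j‖ = 2 := by
    rw [@norm_sub_mul_self 𝕜, hv.1 i, hv.1 j, hv.2 hij, map_zero]
    norm_num
  refine Metric.ball_disjoint_ball ?_
  rw [dist_eq_norm]
  nlinarith [norm_nonneg (v i - v j)]

theorem nonempty_hilbertBasis_nat [CompleteSpace E] [TopologicalSpace.SeparableSpace E]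
    (hE : ¬ FiniteDimensional 𝕜 E) : Nonempty (HilbertBasis ℕ 𝕜 E) := by
  obtain ⟨w, b, -⟩ := exists_hilbertBasis 𝕜 E
  have : Countable w := countable_of_orthonormal b.orthonormal
  have : Infinite w := by
    by_contra hfin
    have := not_infinite_iff_finite.1 hfin
    have := Fintype.ofFinite w
    exact hE b.toOrthonormalBasis.toBasis.finiteDimensional_of_finite
  obtain ⟨f⟩ : Nonempty (ℕ ≃ w) := nonempty_equiv_of_countable
  refine ⟨HilbertBasis.mk (b.orthonormal.comp f f.injective) ?_⟩
  rw [f.surjective.range_comp, b.dense_span]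

theorem nonempty_linearIsometryEquiv {F : Type*} [NormedAddCommGroup F] [InnerProductSpace 𝕜 F]
    [CompleteSpace E] [CompleteSpace F] [TopologicalSpace.SeparableSpace E]
    [TopologicalSpace.SeparableSpace F] (hE : ¬ FiniteDimensional 𝕜 E)
    (hF : ¬ FiniteDimensional 𝕜 F) : Nonempty (E ≃ₗᵢ[𝕜] F) := by
  obtain ⟨b⟩ := nonempty_hilbertBasis_nat hE
  obtain ⟨c⟩ := nonempty_hilbertBasis_nat hF
  exact ⟨b.repr.trans c.repr.symm⟩

end Orthonormal

section Strata

open Cardinal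

theorem toENat_rank_lt_top {K V : Type*} [DivisionRing K] [AddCommGroup V] [Module K V] :
    toENat (Module.rank K V) < ⊤ ↔ FiniteDimensional K V := by
  rw [toENat_lt_top, Module.rank_lt_aleph0_iff]

theorem toENat_rank_eq_top {K V : Type*} [DivisionRing K] [AddCommGroup V] [Module K V] :
    toENat (Module.rank K V) = ⊤ ↔ ¬ FiniteDimensional K V := by
  rw [← toENat_rank_lt_top, not_lt_top_iff]

variable {H : Type*} [NormedAddCommGroup H] [InnerProductSpace ℂ H] [CompleteSpace H] {i j : ℕ∞}
  {P Q : H →L[ℂ] H}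

variable (H i j) in
/-- The pairs in `Delta` of projections of rank `i` and corank `j`. These sets partition `Delta`,
and they turn out to be its connected components. -/
def stratum : Set ((H →L[ℂ] H) × (H →L[ℂ] H)) :=
  Delta H ∩ Proj H i j ×ˢ Proj H i j

theorem exists_isStarProjection_range_eq {S : Submodule ℂ H} (hS : IsClosed (S : Set H)) :
    ∃ P : H →L[ℂ] H, IsStarProjection P ∧ P.range = S := by
  have := hS.completeSpace_coe
  exact ⟨S.starProjection, isStarProjection_starProjection, S.range_starProjection⟩

theorem orthogonal_range_eq_ker (hP : IsStarProjection P) : P.rangeᗮ = P.ker :=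
  hP.isSymmetricProjection.isSymmetric.orthogonal_range

theorem isCompl_range_ker (hP : IsStarProjection P) : IsCompl P.range P.ker :=
  hP.isIdempotentElem.isTopCompl.isCompl

theorem add_eq_top_of_mem_proj (hH : ¬ FiniteDimensional ℂ H) (hP : P ∈ Proj H i j) :
    i + j = ⊤ := by
  rw [← hP.2.1, ← hP.2.2, ← map_add, LinearMap.rank_range_add_rank_ker, toENat_rank_eq_top]
  exact hH

theorem one_sub_mem_proj (hP : P ∈ Proj H i j) : 1 - P ∈ Proj H j i := by
  have hidem := hP.1.isIdempotentElem
  refine ⟨hP.1.one_sub, ?_, ?_⟩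
  · rw [← ker_eq_range_one_sub hidem, hP.2.2]
  · rw [ker_eq_range_one_sub hidem.one_sub, sub_sub_cancel, hP.2.1]

theorem proj_natCast_top_nonempty (hH : ¬ FiniteDimensional ℂ H) (n : ℕ) :
    (Proj H n ⊤).Nonempty := by
  have hn : (n : Cardinal) ≤ Module.rank ℂ H :=
    natCast_le_aleph0.trans (toENat_eq_top.1 (toENat_rank_eq_top.2 hH))
  obtain ⟨v, hv⟩ := Module.le_rank_iff.1 hn
  have := FiniteDimensional.span_of_finite ℂ (Set.finite_range v)
  obtain ⟨P, hP, hrange⟩ :=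
    exists_isStarProjection_range_eq (span ℂ (Set.range v)).closed_of_finiteDimensional
  have hrank : toENat (Module.rank ℂ P.range) = n := by
    rw [hrange, ← Module.finrank_eq_rank, finrank_span_eq_card hv, Fintype.card_fin, toENat_nat]
  have hcorank := add_eq_top_of_mem_proj hH ⟨hP, hrank, rfl⟩
  exact ⟨P, hP, hrank, by simpa using hcorank⟩

theorem proj_top_top_nonempty (hH : ¬ FiniteDimensional ℂ H) : (Proj H ⊤ ⊤).Nonempty := by
  have htop : ¬ FiniteDimensional ℂ (⊤ : Submodule ℂ H) := fun htop ↦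
    hH (topEquiv : (⊤ : Submodule ℂ H) ≃ₗ[ℂ] H).finiteDimensional
  obtain ⟨S, -, T, -, hS, -, hSinf, hTinf, hST⟩ :=
    exists_isOrtho_of_not_finiteDimensional (𝕜 := ℂ) isClosed_univ isClosed_univ htop htop
  obtain ⟨P, hP, rfl⟩ := exists_isStarProjection_range_eq hS
  refine ⟨P, hP, toENat_rank_eq_top.2 hSinf, toENat_rank_eq_top.2 fun hker ↦ hTinf ?_⟩
  rw [← orthogonal_range_eq_ker hP] at hker
  exact finiteDimensional_of_le hST.symm

theorem proj_nonempty (hH : ¬ FiniteDimensional ℂ H) (hij : i + j = ⊤) :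
    (Proj H i j).Nonempty := by
  induction i with
  | top =>
    induction j with
    | top => exact proj_top_top_nonempty hH
    | coe n => exact (proj_natCast_top_nonempty hH n).imp' (1 - ·) fun _ ↦ one_sub_mem_proj
  | coe n =>
    obtain rfl : j = ⊤ := by simpa using hij
    exact proj_natCast_top_nonempty hH n

theorem subset_proj_of_isPreconnected {s : Set (H →L[ℂ] H)} (hs : IsPreconnected s)
    (hproj : ∀ R ∈ s, IsStarProjection R) (hPs : P ∈ s) (hP : P ∈ Proj H i j) :
    s ⊆ Proj H i j := by
  intro Q hQ
  have hidem (R) (hR : R ∈ s) : IsIdempotentElem R := (hproj R hR).isIdempotentElem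
  refine ⟨hproj Q hQ, ?_, ?_⟩
  · rw [rank_range_eq_of_isPreconnected hs hidem hQ hPs, hP.2.1]
  · rw [rank_ker_eq_of_isPreconnected hs hidem hQ hPs, hP.2.2]

theorem setOf_isCompl_range_subset_proj {Z : Submodule ℂ H} (hZ : IsClosed (Z : Set H))
    (hP : P ∈ Proj H i j) (hPZ : IsCompl P.range Z) :
    {R : H →L[ℂ] H | IsStarProjection R ∧ IsCompl R.range Z} ⊆ Proj H i j :=
  subset_proj_of_isPreconnected
    (isPathConnected_setOf_isStarProjection_isCompl_range hZ).isConnected.isPreconnected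
    (fun _ hR ↦ hR.1) ⟨hP.1, hPZ⟩ hP

theorem mem_stratum_of_fst_mem_proj {x : (H →L[ℂ] H) × (H →L[ℂ] H)} (hx : x ∈ Delta H)
    (h : x.1 ∈ Proj H i j) : x ∈ stratum H i j := by
  obtain ⟨-, hx₂, Z, hZ, h₁Z, h₂Z⟩ := id hx
  exact ⟨hx, h, setOf_isCompl_range_subset_proj hZ h h₁Z ⟨hx₂, h₂Z⟩⟩

theorem mk_self_mem_stratum (hP : P ∈ Proj H i j) : (P, P) ∈ stratum H i j :=
  have hcompl := isCompl_range_ker hP.1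
  ⟨⟨hP.1, hP.1, P.ker, P.isClosed_ker, hcompl, hcompl⟩, hP, hP⟩

theorem hasCommonComplement_of_mem_proj (h : i < ⊤ ∨ j < ⊤) (hP : P ∈ Proj H i j)
    (hQ : Q ∈ Proj H i j) : HasCommonComplement P.range Q.range := by
  rcases h with hi | hj
  · have : FiniteDimensional ℂ P.range := toENat_rank_lt_top.1 (hP.2.1 ▸ hi)
    have : FiniteDimensional ℂ Q.range := toENat_rank_lt_top.1 (hQ.2.1 ▸ hi)
    exact exists_isClosed_isCompl_of_finrank_eq
      (congrArg ENat.toNat (hP.2.1.trans hQ.2.1.symm))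
  · have : FiniteDimensional ℂ P.ker := toENat_rank_lt_top.1 (hP.2.2 ▸ hj)
    have : FiniteDimensional ℂ Q.ker := toENat_rank_lt_top.1 (hQ.2.2 ▸ hj)
    let eP := quotientEquivOfIsCompl _ _ (isCompl_range_ker hP.1)
    let eQ := quotientEquivOfIsCompl _ _ (isCompl_range_ker hQ.1)
    have := eP.symm.finiteDimensional
    have := eQ.symm.finiteDimensional
    refine exists_isClosed_isCompl_of_finrank_quotient_eq ?_
    rw [eP.finrank_eq, eQ.finrank_eq]
    exact congrArg ENat.toNat (hP.2.2.trans hQ.2.2.symm)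

theorem stratum_eq_prod (h : i < ⊤ ∨ j < ⊤) : stratum H i j = Proj H i j ×ˢ Proj H i j :=
  Set.inter_eq_right.2 fun _ hx ↦
    ⟨hx.1.1, hx.2.1, hasCommonComplement_of_mem_proj h hx.1 hx.2⟩

theorem joinedIn_proj_of_hasCommonComplement (hP : P ∈ Proj H i j) (hQ : IsStarProjection Q)
    (h : HasCommonComplement P.range Q.range) : JoinedIn (Proj H i j) P Q := by
  obtain ⟨Z, hZ, hPZ, hQZ⟩ := h
  exact ((isPathConnected_setOf_isStarProjection_isCompl_range hZ).joinedIn _ ⟨hP.1, hPZ⟩ _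
    ⟨hQ, hQZ⟩).mono (setOf_isCompl_range_subset_proj hZ hP hPZ)

theorem joinedIn_stratum_diagonal {x : (H →L[ℂ] H) × (H →L[ℂ] H)} (hx : x ∈ stratum H i j) :
    JoinedIn (stratum H i j) x (x.2, x.2) := by
  obtain ⟨⟨hx₁, hx₂, Z, hZ, h₁Z, h₂Z⟩, hx₁ij, hx₂ij⟩ := hx
  have hjoined := (isPathConnected_setOf_isStarProjection_isCompl_range hZ).joinedIn _ ⟨hx₁, h₁Z⟩ _
    ⟨hx₂, h₂Z⟩
  refine (hjoined.prod (JoinedIn.refl (Set.mem_singleton x.2))).mono ?_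
  rintro ⟨R, _⟩ ⟨hR, rfl⟩
  exact ⟨⟨hR.1, hx₂, Z, hZ, hR.2, h₂Z⟩, setOf_isCompl_range_subset_proj hZ hx₁ij h₁Z hR, hx₂ij⟩

section Separable

variable [TopologicalSpace.SeparableSpace H]

theorem joinedIn_proj_top_of_isOrtho (hP : P ∈ Proj H ⊤ ⊤) (hQ : IsStarProjection Q)
    (hQinf : ¬ FiniteDimensional ℂ Q.range) (h : P.range ⟂ Q.range) :
    JoinedIn (Proj H ⊤ ⊤) P Q := by
  have := UniformSpace.secondCountable_of_separable H
  have := hP.1.isIdempotentElem.isClosed_range.completeSpace_coe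
  have := hQ.isIdempotentElem.isClosed_range.completeSpace_coe
  obtain ⟨e⟩ := nonempty_linearIsometryEquiv (toENat_rank_eq_top.1 hP.2.1) hQinf
  exact joinedIn_proj_of_hasCommonComplement hP hQ
    (exists_isClosed_isCompl_of_isOrtho h e.toContinuousLinearEquiv)

theorem joinedIn_proj_top (hP : P ∈ Proj H ⊤ ⊤) (hQ : Q ∈ Proj H ⊤ ⊤) :
    JoinedIn (Proj H ⊤ ⊤) P Q := by
  obtain ⟨S, hSP, T, hTQ, hS, hT, hSinf, hTinf, hST⟩ := exists_isOrtho_of_not_finiteDimensional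
    P.isClosed_ker Q.isClosed_ker (toENat_rank_eq_top.1 hP.2.2) (toENat_rank_eq_top.1 hQ.2.2)
  obtain ⟨E, hE, rfl⟩ := exists_isStarProjection_range_eq hS
  obtain ⟨F, hF, rfl⟩ := exists_isStarProjection_range_eq hT
  rw [← orthogonal_range_eq_ker hP.1] at hSP
  rw [← orthogonal_range_eq_ker hQ.1] at hTQ
  have hPE := joinedIn_proj_top_of_isOrtho hP hE hSinf (IsOrtho.symm hSP)
  have hEF := joinedIn_proj_top_of_isOrtho hPE.target_mem hF hTinf hST
  have hQF := joinedIn_proj_top_of_isOrtho hQ hF hTinf (IsOrtho.symm hTQ)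
  exact (hPE.trans hEF).trans hQF.symm

theorem joinedIn_proj (hP : P ∈ Proj H i j) (hQ : Q ∈ Proj H i j) : JoinedIn (Proj H i j) P Q := by
  by_cases h : i < ⊤ ∨ j < ⊤
  · exact joinedIn_proj_of_hasCommonComplement hP hQ.1 (hasCommonComplement_of_mem_proj h hP hQ)
  · simp only [not_or, not_lt_top_iff] at h
    obtain ⟨rfl, rfl⟩ := h
    exact joinedIn_proj_top hP hQ

theorem isPathConnected_stratum (hH : ¬ FiniteDimensional ℂ H) (hij : i + j = ⊤) :
    IsPathConnected (stratum H i j) := by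
  rw [isPathConnected_iff]
  refine ⟨(proj_nonempty hH hij).imp' (fun P ↦ (P, P)) fun _ ↦ mk_self_mem_stratum,
    fun x hx y hy ↦ ?_⟩
  have hdiag : JoinedIn (stratum H i j) (x.2, x.2) (y.2, y.2) := by
    refine ((joinedIn_proj hx.2.2 hy.2.2).map (f := fun R ↦ (R, R)) (by fun_prop)).mono ?_
    exact Set.image_subset_iff.2 fun _ ↦ mk_self_mem_stratum
  exact ((joinedIn_stratum_diagonal hx).trans hdiag).trans (joinedIn_stratum_diagonal hy).symm

theorem connectedComponentIn_delta_eq_stratum (hH : ¬ FiniteDimensional ℂ H)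
    {x : (H →L[ℂ] H) × (H →L[ℂ] H)} (hx : x ∈ stratum H i j) :
    connectedComponentIn (Delta H) x = stratum H i j := by
  have hsub := connectedComponentIn_subset (Delta H) x
  have hfst : Prod.fst '' connectedComponentIn (Delta H) x ⊆ Proj H i j := by
    refine subset_proj_of_isPreconnected
      (isPreconnected_connectedComponentIn.image _ continuous_fst.continuousOn) ?_
      (Set.mem_image_of_mem _ (mem_connectedComponentIn hx.1)) hx.2.1
    rintro _ ⟨y, hy, rfl⟩
    exact (hsub hy).1
  refine Set.Subset.antisymm
    (fun y hy ↦ mem_stratum_of_fst_mem_proj (hsub hy) (hfst (Set.mem_image_of_mem _ hy))) ?_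
  have hconn := isPathConnected_stratum hH (add_eq_top_of_mem_proj hH hx.2.1)
  exact hconn.isConnected.isPreconnected.subset_connectedComponentIn hx Set.inter_subset_left

theorem setOf_connectedComponentIn_delta (hH : ¬ FiniteDimensional ℂ H) :
    {C | ∃ x ∈ Delta H, C = connectedComponentIn (Delta H) x} =
      {C | ∃ i j : ℕ∞, i + j = ⊤ ∧ C = stratum H i j} := by
  ext C
  constructor
  · rintro ⟨x, hx, rfl⟩
    have hx₁ : x.1 ∈ Proj H _ _ := ⟨hx.1, rfl, rfl⟩
    exact ⟨_, _, add_eq_top_of_mem_proj hH hx₁,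
      connectedComponentIn_delta_eq_stratum hH (mem_stratum_of_fst_mem_proj hx hx₁)⟩
  · rintro ⟨i, j, hij, rfl⟩
    obtain ⟨x, hx⟩ := (isPathConnected_stratum hH hij).nonempty
    exact ⟨x, hx.1, (connectedComponentIn_delta_eq_stratum hH hx).symm⟩

end Separable

end Strata

end CommonComplement

open CommonComplement

theorem mainTheorem2 (H : Type*) [NormedAddCommGroup H] [InnerProductSpace ℂ H] [CompleteSpace H]
    [TopologicalSpace.SeparableSpace H] (hH : ¬ FiniteDimensional ℂ H) :
    IsPathConnected (CommonComplement.DeltaInf H) ∧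
    (∀ x ∈ CommonComplement.DeltaInf H,
      connectedComponentIn (CommonComplement.Delta H) x = CommonComplement.DeltaInf H) ∧
    {C | ∃ x ∈ CommonComplement.Delta H,
        C = connectedComponentIn (CommonComplement.Delta H) x} =
      {C | ∃ i j : ℕ∞, i + j = ⊤ ∧ (i < ⊤ ∨ j < ⊤) ∧
        C = CommonComplement.Proj H i j ×ˢ CommonComplement.Proj H i j} ∪
      {CommonComplement.DeltaInf H} := by
  refine ⟨isPathConnected_stratum hH rfl,
    fun x hx ↦ connectedComponentIn_delta_eq_stratum hH hx, ?_⟩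
  rw [setOf_connectedComponentIn_delta hH]
  ext C
  constructor
  · rintro ⟨i, j, hij, rfl⟩
    by_cases h : i < ⊤ ∨ j < ⊤
    · exact Or.inl ⟨i, j, hij, h, stratum_eq_prod h⟩
    · simp only [not_or, not_lt_top_iff] at h
      obtain ⟨rfl, rfl⟩ := h
      exact Or.inr rfl
  · rintro (⟨i, j, hij, h, rfl⟩ | rfl)
    · exact ⟨i, j, hij, (stratum_eq_prod h).symm⟩
    · exact ⟨⊤, ⊤, rfl, rfl⟩
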